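/- For $g\ge 0$ let $\pi_g=\langle a_1,b_1,\dots,a_g,b_g \mid [a_1,b_1]\cdots[a_g,b_g]\rangle$ be the fundamental group of the closed orientable surface of genus $g$. A group is finitely presentable if it is the quotient of a free group of finite rank by the normal closure of a finite set. A finite presentation of a group $G$ is an epimorphism $a:A\to G$ where $A$ is a finitely presentable group and $\operatorname{Ker} a$ is the normal closure of a finitely generated subgroup of $A$. Cohomology of groups is taken with coefficients in the trivial module $\mathbb{R}$. Let $\Gamma$ be a finitely presentable abelian group such that $H^2(\Gamma;\mathbb{R})\neq 0$. Then there exist $g\ge 0$ and a finite presentation $p_\Gamma:\pi_g\to\Gamma$ such that the induced map $$p_\Gamma^*: H^2(\Gamma;\mathbb{R})\to H^2(\pi_g;\mathbb{R})$$ is non-zero. -/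

import Mathlib

open CategoryTheory

/-- The word `[a₁, b₁] ⋯ [a_g, b_g]` in the free group on `a₁, …, a_g, b₁, …, b_g`, where
`a_i` is `Sum.inl i`, `b_i` is `Sum.inr i` and `[a, b] = a * b * a⁻¹ * b⁻¹`. -/
def surfaceRelator (g : ℕ) : FreeGroup (Fin g ⊕ Fin g) :=
  (List.ofFn fun i : Fin g =>
    FreeGroup.of (Sum.inl i) * FreeGroup.of (Sum.inr i) *
      (FreeGroup.of (Sum.inl i))⁻¹ * (FreeGroup.of (Sum.inr i))⁻¹).prod

/-- The surface group `π_g = ⟨a₁, b₁, …, a_g, b_g ∣ [a₁, b₁] ⋯ [a_g, b_g]⟩`, the fundamental group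
of the closed orientable surface of genus `g`. -/
abbrev SurfaceGroup (g : ℕ) : Type :=
  PresentedGroup ({surfaceRelator g} : Set (FreeGroup (Fin g ⊕ Fin g)))

/-- A finite presentation of a group `G`: an epimorphism `a : A → G` from a finitely presentable
group `A` such that `ker a` is the normal closure of a finitely generated subgroup of `A`. -/
structure IsFinitePresentation {A G : Type*} [Group A] [Group G] (a : A →* G) : Prop where
  finitelyPresented : Group.IsFinitelyPresented A
  surjective : Function.Surjective a
  ker_eq : ∃ K : Subgroup A, K.FG ∧ Subgroup.normalClosure (K : Set A) = a.ker

/-- `Hⁿ(G; ℝ)`: group cohomology with coefficients in the trivial `G`-module `ℝ`. -/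
noncomputable abbrev realCohomology (G : Type) [Group G] (n : ℕ) : ModuleCat ℝ :=
  groupCohomology (Rep.trivial ℝ G ℝ) n

/-- The map `f^* : Hⁿ(H; ℝ) → Hⁿ(G; ℝ)` induced by a group homomorphism `f : G → H` and the
identity of the coefficients. -/
noncomputable def realCohomologyMap {G H : Type} [Group G] [Group H] (f : G →* H) (n : ℕ) :
    realCohomology H n ⟶ realCohomology G n :=
  groupCohomology.map (A := Rep.trivial ℝ H ℝ) (B := Rep.trivial ℝ G ℝ) f
    (𝟙 (Rep.trivial ℝ G ℝ)) n

/-! A cocycle `f` with non-zero class is not symmetric: a symmetric one defines an abelian extension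
of `Γ` by `ℝ`, which splits because `ℝ` is divisible. So `f (x, y) ≠ f (y, x)` for some `x`, `y`,
and lifts of `x` and `y` to the central extension do not commute. Send the first handle of a surface
group to `(x, y)` and the others to `(t, 1)`, with `t` running over generators of `Γ`. If the
pulled-back class vanished, this map would lift to the extension; the handles over `(t, 1)` would
have trivial commutators there, and the surface relation would make the lifts of `x` and `y` commute
(`SurfaceGroup.commute_zero`). -/

/-- The kernel of an epimorphism from a finitely generated group onto a finitely presented group is
the normal closure of a finite set. -/
theorem MonoidHom.ker_isFinitelyNormallyGenerated {A G : Type*} [Group A] [Group G] [Group.FG A]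
    [hG : Group.IsFinitelyPresented G] (a : A →* G) (ha : Function.Surjective a) :
    a.ker.IsFinitelyNormallyGenerated := by
  obtain ⟨n, φ, hφ, R, hR, hRφ⟩ := hG.out
  obtain ⟨S, hS, hSfin⟩ := (Subgroup.fg_iff _).1 (Group.FG.out (G := A))
  choose w hw using fun s : A => hφ (a s)
  let ψ : FreeGroup (Fin n) →* A := FreeGroup.lift fun i => (ha (φ (FreeGroup.of i))).choose
  have hψ : ∀ v, a (ψ v) = φ v := by
    have : a.comp ψ = φ := by
      ext i
      simpa [ψ] using (ha (φ (FreeGroup.of i))).choose_spec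
    exact fun v => DFunLike.congr_fun this v
  -- The relators of `G` carried to `A`, and for each generator `s` of `A` a relation rewriting it
  -- as a word in the chosen lifts of the generators of `G`.
  let T : Set A := Set.image ψ R ∪ Set.image (fun s => s * (ψ (w s))⁻¹) S
  have hT : Subgroup.normalClosure T ≤ a.ker := by
    refine Subgroup.normalClosure_le_normal ?_
    rintro _ (⟨r, hr, rfl⟩ | ⟨s, -, rfl⟩)
    · have : r ∈ φ.ker := hRφ ▸ Subgroup.subset_normalClosure hr
      simpa [MonoidHom.mem_ker, hψ] using this
    · simp [MonoidHom.mem_ker, hψ, hw]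
  refine ⟨T, (hR.image _).union (hSfin.image _), le_antisymm hT ?_⟩
  let N := Subgroup.normalClosure T
  let q := QuotientGroup.mk' N
  have hq : (q.comp ψ).range = ⊤ := by
    rw [eq_top_iff, ← MonoidHom.range_eq_top.2 (QuotientGroup.mk'_surjective N),
      MonoidHom.range_eq_map, ← hS, MonoidHom.map_closure, Subgroup.closure_le]
    rintro _ ⟨s, hs, rfl⟩
    refine ⟨w s, Eq.symm ?_⟩
    have : s * (ψ (w s))⁻¹ ∈ q.ker := by
      rw [QuotientGroup.ker_mk']
      exact Subgroup.subset_normalClosure (Or.inr ⟨s, hs, rfl⟩)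
    rw [MonoidHom.mem_ker, map_mul, map_inv, mul_inv_eq_one] at this
    exact this
  have hker : φ.ker ≤ N.comap ψ := by
    rw [← hRφ]
    refine Subgroup.normalClosure_le_normal fun r hr => ?_
    exact Subgroup.subset_normalClosure (Or.inl ⟨r, hr, rfl⟩)
  -- Modulo `N`, `x` is some `ψ v`; then `φ v = 1`, so `ψ v` already lies in `N`.
  intro x hx
  obtain ⟨v, hv⟩ := MonoidHom.range_eq_top.1 hq (q x)
  have hvx : (ψ v)⁻¹ * x ∈ N := QuotientGroup.eq.1 hv
  have hav : a (ψ v) = 1 := by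
    have : (ψ v)⁻¹ * x ∈ a.ker := hT hvx
    rw [MonoidHom.mem_ker] at this hx
    simpa [hx] using this
  have hvN : ψ v ∈ N := hker (by rw [MonoidHom.mem_ker, ← hψ, hav])
  simpa using N.mul_mem hvN hvx

/-- An epimorphism from a finitely presented group onto a finitely presented group is a finite
presentation. -/
theorem IsFinitePresentation.of_surjective {A G : Type*} [Group A] [Group G]
    [hA : Group.IsFinitelyPresented A] [Group.IsFinitelyPresented G] (a : A →* G)
    (ha : Function.Surjective a) : IsFinitePresentation a := by
  have : Group.FG A := by
    obtain ⟨n, φ, hφ, -⟩ := hA.out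
    exact Group.fg_of_surjective hφ
  obtain ⟨S, hS, hSa⟩ := a.ker_isFinitelyNormallyGenerated ha
  refine ⟨hA, ha, Subgroup.closure S, (Subgroup.fg_iff _).2 ⟨S, rfl, hS⟩, ?_⟩
  rw [Subgroup.normalClosure_closure_eq_normalClosure, hSa]

/-- The central extension of `G` by `M` defined by a `2`-cocycle `f` with values in the trivial
module `M`; its underlying set is `M × G`. -/
@[ext]
structure CocycleExtension {G M : Type*} [Group G] [AddCommGroup M] (f : G × G → M)
    (hf : ∀ g h j, f (g * h, j) + f (g, h) = f (h, j) + f (g, h * j)) where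
  /-- The coordinate in the central subgroup. -/
  fst : M
  /-- The projection to the quotient group. -/
  snd : G

namespace CocycleExtension

variable {G M : Type*} [Group G] [AddCommGroup M] {f : G × G → M}
  {hf : ∀ g h j, f (g * h, j) + f (g, h) = f (h, j) + f (g, h * j)}

instance : Mul (CocycleExtension f hf) :=
  ⟨fun x y => ⟨x.fst + y.fst + f (x.snd, y.snd), x.snd * y.snd⟩⟩

/-- The cocycle is not assumed normalized, hence the correction by `f (1, 1)` here, in inverses and
in `inl`. -/
instance : One (CocycleExtension f hf) := ⟨⟨-f (1, 1), 1⟩⟩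

instance : Inv (CocycleExtension f hf) :=
  ⟨fun x => ⟨-x.fst - f (x.snd⁻¹, x.snd) - f (1, 1), x.snd⁻¹⟩⟩

@[simp] theorem fst_mul (x y : CocycleExtension f hf) :
    (x * y).fst = x.fst + y.fst + f (x.snd, y.snd) := rfl

@[simp] theorem snd_mul (x y : CocycleExtension f hf) : (x * y).snd = x.snd * y.snd := rfl

@[simp] theorem fst_one : (1 : CocycleExtension f hf).fst = -f (1, 1) := rfl

@[simp] theorem snd_one : (1 : CocycleExtension f hf).snd = 1 := rfl

@[simp] theorem fst_inv (x : CocycleExtension f hf) :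
    x⁻¹.fst = -x.fst - f (x.snd⁻¹, x.snd) - f (1, 1) := rfl

@[simp] theorem snd_inv (x : CocycleExtension f hf) : x⁻¹.snd = x.snd⁻¹ := rfl

theorem cocycle_one_left (hf : ∀ g h j, f (g * h, j) + f (g, h) = f (h, j) + f (g, h * j))
    (g : G) : f (1, g) = f (1, 1) := by
  simpa using (hf 1 1 g).symm

theorem cocycle_one_right (hf : ∀ g h j, f (g * h, j) + f (g, h) = f (h, j) + f (g, h * j))
    (g : G) : f (g, 1) = f (1, 1) := by
  simpa using hf g 1 1

instance : Group (CocycleExtension f hf) :=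
  Group.ofLeftAxioms
    (fun x y z => by
      ext
      · have := hf x.snd y.snd z.snd
        simp only [fst_mul, snd_mul]
        calc
          _ = x.fst + y.fst + z.fst + (f (x.snd * y.snd, z.snd) + f (x.snd, y.snd)) := by abel
          _ = _ := by rw [this]; abel
      · simp [mul_assoc])
    (fun x => by ext <;> simp [cocycle_one_left hf])
    (fun x => by
      ext
      · simp only [fst_mul, fst_inv, snd_inv, fst_one]
        abel
      · simp)

/-- Elements with commuting projections commute exactly when the cocycle is symmetric on the
projections. -/
theorem commute_iff {x y : CocycleExtension f hf} (h : Commute x.snd y.snd) :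
    Commute x y ↔ f (x.snd, y.snd) = f (y.snd, x.snd) := by
  rw [commute_iff_eq, CocycleExtension.ext_iff, fst_mul, fst_mul, snd_mul, snd_mul,
    add_comm y.fst x.fst, add_right_inj]
  exact and_iff_left h.eq

/-- The inclusion of the central subgroup. -/
def inl : M →+ Additive (CocycleExtension f hf) where
  toFun c := Additive.ofMul ⟨c - f (1, 1), 1⟩
  map_zero' := by
    rw [zero_sub]
    rfl
  map_add' c d := by
    refine congrArg Additive.ofMul ?_
    ext
    · change c + d - f (1, 1) = c - f (1, 1) + (d - f (1, 1)) + f (1, 1)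
      abel
    · exact (mul_one 1).symm

theorem inl_injective : Function.Injective (inl (f := f) (hf := hf)) := fun _ _ h =>
  sub_left_injective (congrArg (fun x => (Additive.toMul x).fst) h)

/-- A trivialization of the pullback of the cocycle `f` along `p` lifts `p` to the extension. -/
def lift {P : Type*} [Group P] (p : P →* G) (φ : P → M)
    (hφ : ∀ x y, φ y - φ (x * y) + φ x = f (p x, p y)) : P →* CocycleExtension f hf :=
  MonoidHom.mk' (fun x => ⟨-φ x, p x⟩) fun x y => by
    ext
    · simp only [fst_mul, ← hφ]
      abel
    · simp

@[simp] theorem snd_lift {P : Type*} [Group P] (p : P →* G) (φ : P → M)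
    (hφ : ∀ x y, φ y - φ (x * y) + φ x = f (p x, p y)) (x : P) :
    (lift (hf := hf) p φ hφ x).snd = p x := rfl

end CocycleExtension

open CocycleExtension in
/-- A symmetric `2`-cocycle on an abelian group with values in a divisible group is a
coboundary. -/
theorem exists_coboundary_of_symmetric {G M : Type*} [CommGroup G] [AddCommGroup M]
    [DivisibleBy M ℤ] (f : G × G → M)
    (hf : ∀ g h j, f (g * h, j) + f (g, h) = f (h, j) + f (g, h * j))
    (hsymm : ∀ g h, f (g, h) = f (h, g)) :
    ∃ φ : G → M, ∀ g h, φ h - φ (g * h) + φ g = f (g, h) := by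
  let _ : CommGroup (CocycleExtension f hf) :=
    { mul_comm := fun x y => (commute_iff (Commute.all _ _)).2 (hsymm _ _) }
  -- Divisible groups are injective, so the central subgroup has a retraction `ρ`; its values on the
  -- section `g ↦ (0, g)` form the required cochain.
  obtain ⟨ρ, hρ⟩ := (Module.Baer.of_divisible M).extension_property_addMonoidHom
    (inl (f := f) (hf := hf)) inl_injective (AddMonoidHom.id M)
  refine ⟨fun g => ρ (Additive.ofMul ⟨0, g⟩), fun g h => ?_⟩
  have key : Additive.ofMul (⟨0, g⟩ : CocycleExtension f hf) + Additive.ofMul ⟨0, h⟩ =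
      inl (f (g, h)) + Additive.ofMul ⟨0, g * h⟩ := by
    refine congrArg Additive.ofMul (CocycleExtension.ext ?_ ?_)
    · change 0 + 0 + f (g, h) = f (g, h) - f (1, 1) + 0 + f (1, g * h)
      rw [cocycle_one_left hf (g * h)]
      abel
    · exact (one_mul _).symm
  have h1 := congrArg ρ key
  have h2 : ρ (inl (f (g, h))) = f (g, h) := DFunLike.congr_fun hρ _
  rw [map_add, map_add, h2] at h1
  rw [sub_add_eq_add_sub, add_comm, h1, add_sub_cancel_right]

/-- The homomorphism from the surface group to an abelian group with prescribed values on the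
standard generators. -/
def SurfaceGroup.toCommGroup {G : Type*} [CommGroup G] {g : ℕ} (u : Fin g ⊕ Fin g → G) :
    SurfaceGroup g →* G :=
  PresentedGroup.toGroup (f := u) <| by
    rintro _ rfl
    simp [surfaceRelator, map_list_prod, List.map_ofFn, Function.comp_def]

@[simp] theorem SurfaceGroup.toCommGroup_of {G : Type*} [CommGroup G] {g : ℕ}
    (u : Fin g ⊕ Fin g → G) (i : Fin g ⊕ Fin g) :
    SurfaceGroup.toCommGroup u (PresentedGroup.of i) = u i :=
  PresentedGroup.toGroup.of _

/-- If all pairs of standard generators but the first commute in the image of a homomorphism from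
a surface group, then so does the first pair. -/
theorem SurfaceGroup.commute_zero {E : Type*} [Group E] {n : ℕ} (s : SurfaceGroup (n + 1) →* E)
    (hs : ∀ i : Fin n, Commute (s (PresentedGroup.of (Sum.inl i.succ)))
      (s (PresentedGroup.of (Sum.inr i.succ)))) :
    Commute (s (PresentedGroup.of (Sum.inl 0))) (s (PresentedGroup.of (Sum.inr 0))) := by
  have hrel : (s.comp (PresentedGroup.mk _)) (surfaceRelator (n + 1)) = 1 := by
    rw [MonoidHom.comp_apply, PresentedGroup.one_of_mem (Set.mem_singleton _), map_one]
  have hof (i) : (s.comp (PresentedGroup.mk _)) (FreeGroup.of i) = s (PresentedGroup.of i) := rfl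
  simp only [← hof] at hs ⊢
  generalize s.comp (PresentedGroup.mk _) = q at hrel hs
  -- The later commutators die, so the relator collapses to the first one.
  have htail (i : Fin n) : q (FreeGroup.of (Sum.inl i.succ)) * q (FreeGroup.of (Sum.inr i.succ)) *
      (q (FreeGroup.of (Sum.inl i.succ)))⁻¹ * (q (FreeGroup.of (Sum.inr i.succ)))⁻¹ = 1 := by
    rw [(hs i).eq, mul_inv_cancel_right, mul_inv_cancel]
  simp only [surfaceRelator, List.ofFn_succ, List.prod_cons, map_mul, map_inv, map_list_prod,
    List.map_ofFn, Function.comp_def, htail, List.ofFn_const, List.prod_replicate, one_pow,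
    mul_one] at hrel
  rw [mul_inv_eq_one, mul_inv_eq_iff_eq_mul] at hrel
  exact hrel

theorem mainTheorem12 (Γ : Type) [CommGroup Γ] (hΓ : Group.IsFinitelyPresented Γ)
    (hH : Nontrivial (realCohomology Γ 2)) :
    ∃ (g : ℕ) (p : SurfaceGroup g →* Γ),
      IsFinitePresentation p ∧ realCohomologyMap p 2 ≠ 0 := by
  obtain ⟨c, hc⟩ := exists_ne (0 : realCohomology Γ 2)
  induction c using groupCohomology.H2_induction_on with | h f =>
  have hf (g h j : Γ) : f (g * h, j) + f (g, h) = f (h, j) + f (g, h * j) := by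
    simpa using (groupCohomology.mem_cocycles₂_iff f).1 f.2 g h j
  have hf' : ¬ ∀ g h, f (g, h) = f (h, g) := by
    intro hsymm
    obtain ⟨φ, hφ⟩ := exists_coboundary_of_symmetric (M := ℝ) f hf hsymm
    refine hc ((groupCohomology.H2π_eq_zero_iff f).2 ⟨φ, ?_⟩)
    ext ⟨g, h⟩
    exact hφ g h
  push Not at hf'
  obtain ⟨x, y, hxy⟩ := hf'
  obtain ⟨n, t, ht, -⟩ := hΓ.out
  -- One handle detects the asymmetry of `f`; the other `n` make `p` surjective.
  let p : SurfaceGroup (n + 1) →* Γ := SurfaceGroup.toCommGroup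
    (Sum.elim (Fin.cons x fun i => t (FreeGroup.of i)) (Fin.cons y fun _ => 1))
  have hp : Function.Surjective p := by
    let r : FreeGroup (Fin n) →* SurfaceGroup (n + 1) :=
      FreeGroup.lift fun i => PresentedGroup.of (Sum.inl i.succ)
    have hr : p.comp r = t := by
      ext i
      simp [p, r]
    exact Function.Surjective.of_comp (g := r) (by rw [← MonoidHom.coe_comp, hr]; exact ht)
  refine ⟨n + 1, p, IsFinitePresentation.of_surjective p hp, fun hzero => hxy ?_⟩
  have hπ : groupCohomology.H2π _ (groupCohomology.mapCocycles₂ (A := Rep.trivial ℝ Γ ℝ)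
      (B := Rep.trivial ℝ (SurfaceGroup (n + 1)) ℝ) p (𝟙 _) f) = 0 := by
    refine (groupCohomology.H2π_comp_map_apply (A := Rep.trivial ℝ Γ ℝ)
      (B := Rep.trivial ℝ (SurfaceGroup (n + 1)) ℝ) p (𝟙 _) f).symm.trans ?_
    exact congrArg (fun F => F.hom (groupCohomology.H2π _ f)) hzero
  obtain ⟨φ, hφ⟩ := (groupCohomology.H2π_eq_zero_iff _).1 hπ
  have hφ' (u v : SurfaceGroup (n + 1)) : φ v - φ (u * v) + φ u = f (p u, p v) :=
    congrFun hφ (u, v)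
  have hcomm := SurfaceGroup.commute_zero (CocycleExtension.lift (M := ℝ) (hf := hf) p φ hφ')
    fun i => (CocycleExtension.commute_iff (Commute.all _ _)).2 <| by
      -- Each later `b_i` maps to `1`, and `f (g, 1) = f (1, 1) = f (1, g)`.
      simp [p, CocycleExtension.cocycle_one_left hf, CocycleExtension.cocycle_one_right hf]
  simpa [p] using (CocycleExtension.commute_iff (Commute.all _ _)).1 hcomm
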